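/- Let $\mathfrak n$ be a finite-dimensional real nilpotent Lie algebra with an inner product $\langle\cdot,\cdot\rangle_1$ whose Ricci operator (that of the corresponding left-invariant metric) is $\mathrm{Ric}_1=cI+D_1$ with $c<0$ and $D_1\in\mathrm{Der}(\mathfrak n)$ (a nilsoliton), and let $\mathfrak a\subset\mathrm{Der}(\mathfrak n)$ be an abelian Lie subalgebra all of whose elements are symmetric with respect to $\langle\cdot,\cdot\rangle_1$. Let $S$ be the semidirect product $\mathfrak s=\mathfrak a\oplus\mathfrak n$, where $[A,X]=A(X)$ for $A\in\mathfrak a$, $X\in\mathfrak n$, with the inner product given by $$\langle\cdot,\cdot\rangle|_{\mathfrak n\times\mathfrak n}=\langle\cdot,\cdot\rangle_1,\qquad \langle\mathfrak a,\mathfrak n\rangle=0,\qquad \langle A,A\rangle=-\tfrac1c\,\mathrm{tr}(A^2)\quad(A\in\mathfrak a).$$ Let $H\in\mathfrak s$ be its mean curvature vector, defined by $\langle H,Y\rangle=\mathrm{tr}(\mathrm{ad}\,Y)$ for all $Y\in\mathfrak s$. Then $H\in\mathfrak a$, and $S$ is a solsoliton, i.e. $\mathfrak s$ is solvable and its Ricci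 operator is the sum of a multiple of the identity and a derivation; more precisely, $$\mathrm{Ric}=cI+D,\qquad D\in\mathrm{Der}(\mathfrak s),\qquad D|_{\mathfrak a}=0,\qquad D|_{\mathfrak n}=D_1-\mathrm{ad}H|_{\mathfrak n}.$$ Furthermore, $\mathrm{Ric}=cI$ if and only if $D_1\in\mathfrak a$; and, except when $\mathfrak a=0$ and $\mathfrak n$ is abelian and nonzero (so that $S$ is a flat Euclidean space), $S$ is Einstein, i.e. $\mathrm{Ric}=kI$ for some $k\in\mathbb R$, if and only if $D_1\in\mathfrak a$. -/

import Mathlib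

open scoped LieAlgebra

/-- An inner product (positive definite symmetric bilinear form) on a real Lie algebra `L`.
It stands for the left-invariant Riemannian metric that it determines on a Lie group with Lie
algebra `L`. -/
structure LieInner (L : Type*) [LieRing L] [LieAlgebra ℝ L] where
  /-- the bilinear form `⟨·,·⟩` -/
  form : LinearMap.BilinForm ℝ L
  symm : ∀ X Y, form X Y = form Y X
  pos : ∀ X, X ≠ 0 → 0 < form X X

namespace LieInner

section General

variable {L : Type*} [LieRing L] [LieAlgebra ℝ L] (g : LieInner L)

theorem nondegenerate : g.form.Nondegenerate := by
  refine ⟨fun X h => ?_, fun X h => ?_⟩ <;>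
  · by_contra hX
    exact (g.pos X hX).ne' (h X)

variable [FiniteDimensional ℝ L]

/-- The vector that represents a linear functional: `⟨g.riesz f, Y⟩ = f Y`. -/
noncomputable def riesz : Module.Dual ℝ L →ₗ[ℝ] L :=
  (g.form.toDual g.nondegenerate).symm.toLinearMap

theorem form_riesz (f : Module.Dual ℝ L) (Y : L) : g.form (g.riesz f) Y = f Y :=
  LinearMap.BilinForm.apply_toDual_symm_apply f Y

/-- The Levi-Civita connection on left-invariant vector fields, `∇_X Y = g.nabla X Y`, given by
the Koszul formula `2⟨∇_X Y, Z⟩ = ⟨[X,Y],Z⟩ - ⟨[Y,Z],X⟩ + ⟨[Z,X],Y⟩`. -/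
noncomputable def nabla : L →ₗ[ℝ] L →ₗ[ℝ] L :=
  LinearMap.mk₂ ℝ
    (fun X Y => g.riesz ((1 / 2 : ℝ) • (g.form ⁅X, Y⁆ - g.form X ∘ₗ (LieAlgebra.ad ℝ L Y)
      - g.form Y ∘ₗ (LieAlgebra.ad ℝ L X))))
    (fun X X' Y => by
      rw [← map_add]; congr 1; ext Z; simp; ring)
    (fun c X Y => by
      rw [← map_smul]; congr 1; ext Z; simp; ring)
    (fun X Y Y' => by
      rw [← map_add]; congr 1; ext Z; simp; ring)
    (fun c X Y => by
      rw [← map_smul]; congr 1; ext Z; simp; ring)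

theorem koszul (X Y Z : L) :
    2 * g.form (g.nabla X Y) Z = g.form ⁅X, Y⁆ Z - g.form ⁅Y, Z⁆ X + g.form ⁅Z, X⁆ Y := by
  have h : g.form ⁅Z, X⁆ Y = -g.form ⁅X, Z⁆ Y := by
    rw [← lie_skew Z X, map_neg, LinearMap.neg_apply]
  rw [nabla, LinearMap.mk₂_apply, form_riesz, h, g.symm ⁅Y, Z⁆ X]
  simp [g.symm Y]
  ring

/-- The Riemann curvature tensor `R(X,Y) = [∇_X, ∇_Y] - ∇_[X,Y]`. -/
noncomputable def curvature : L →ₗ[ℝ] L →ₗ[ℝ] Module.End ℝ L :=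
  LinearMap.mk₂ ℝ (fun X Y => g.nabla X ∘ₗ g.nabla Y - g.nabla Y ∘ₗ g.nabla X - g.nabla ⁅X, Y⁆)
    (fun X X' Y => by ext Z; simp; abel)
    (fun c X Y => by ext Z; simp [smul_sub])
    (fun X Y Y' => by ext Z; simp; abel)
    (fun c X Y => by ext Z; simp [smul_sub])

/-- The Ricci tensor `ric(X,Y) = tr (Z ↦ R(Z,X)Y)`. -/
noncomputable def ricciForm : LinearMap.BilinForm ℝ L :=
  LinearMap.mk₂ ℝ (fun X Y => LinearMap.trace ℝ L ((g.curvature.flip X).flip Y))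
    (fun X X' Y => by rw [← map_add]; congr 1; ext Z; simp)
    (fun c X Y => by rw [← map_smul]; congr 1; ext Z; simp)
    (fun X Y Y' => by rw [← map_add]; congr 1; ext Z; simp)
    (fun c X Y => by rw [← map_smul]; congr 1; ext Z; simp)

/-- The Ricci operator, `⟨Ric X, Y⟩ = ric(X,Y)`. -/
noncomputable def ricci : Module.End ℝ L := g.riesz ∘ₗ g.ricciForm

/-- The mean curvature vector `H`: `⟨H, X⟩ = tr (ad X)` for all `X`. For `X` in the nilradical
`ad X` is nilpotent, so `H` is orthogonal to the nilradical. -/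
noncomputable def meanCurvature : L :=
  g.riesz (LinearMap.trace ℝ L ∘ₗ (LieAlgebra.ad ℝ L : L →ₗ[ℝ] Module.End ℝ L))

theorem form_meanCurvature (X : L) :
    g.form g.meanCurvature X = LinearMap.trace ℝ L (LieAlgebra.ad ℝ L X) :=
  g.form_riesz _ X

/-- `H` is orthogonal to every nilpotent ideal, hence to the nilradical. -/
theorem form_meanCurvature_eq_zero (I : LieIdeal ℝ L) [LieRing.IsNilpotent I] {X : L}
    (hX : X ∈ I) : g.form g.meanCurvature X = 0 := by
  rw [form_meanCurvature]
  have hn : IsNilpotent (LieAlgebra.ad ℝ I ⟨X, hX⟩) :=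
    LieModule.isNilpotent_toEnd_of_isNilpotent ℝ (L := I) (M := I) ⟨X, hX⟩
  obtain ⟨k, hk⟩ := hn
  have hpow : ∀ (m : ℕ) (Y : I),
      ((LieAlgebra.ad ℝ L X) ^ m) (Y : L) = (((LieAlgebra.ad ℝ I ⟨X, hX⟩) ^ m) Y : I) := by
    intro m
    induction m with
    | zero => intro Y; simp
    | succ m ih =>
      intro Y
      rw [pow_succ, pow_succ, Module.End.mul_apply, Module.End.mul_apply, ← ih]
      rfl
  have : IsNilpotent (LieAlgebra.ad ℝ L X) := by
    refine ⟨k + 1, ?_⟩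
    ext Y
    have hm : ⁅X, Y⁆ ∈ I := lie_mem_left ℝ L I X Y hX
    have := hpow k ⟨⁅X, Y⁆, hm⟩
    rw [hk] at this
    simpa [pow_succ] using this
  exact (LinearMap.isNilpotent_trace_of_isNilpotent this).eq_zero

/-- The metric is Einstein: `Ric = k I` for some constant `k`. -/
def IsEinstein : Prop := ∃ k : ℝ, g.ricci = k • LinearMap.id

/-- A solsoliton: a solvable Lie algebra with an inner product whose Ricci operator is the sum of
a multiple of the identity and a derivation. -/
def IsSolsoliton : Prop :=
  LieAlgebra.IsSolvable L ∧
    ∃ (c : ℝ) (D : LieDerivation ℝ L L), g.ricci = c • LinearMap.id + (D : L →ₗ[ℝ] L)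

end General

section Construction

variable {N : Type*} [LieRing N] [LieAlgebra ℝ N]

/-- The derivation `A` is symmetric with respect to the inner product. -/
def IsSymmDer (g : LieInner N) (A : LieDerivation ℝ N N) : Prop :=
  ∀ X Y, g.form (A X) Y = g.form X (A Y)

/-- For a Lie algebra `𝔞` of derivations of `N`, the semidirect product `𝔞 ⊕ N`, in which
`[A, X] = A X` for `A ∈ 𝔞` and `X ∈ N`. -/
abbrev Semi (𝔞 : LieSubalgebra ℝ (LieDerivation ℝ N N)) : Type _ := N ⋊⁅𝔞.incl⁆ 𝔞

instance instFiniteDimensionalSemi [FiniteDimensional ℝ N]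
    (𝔞 : LieSubalgebra ℝ (LieDerivation ℝ N N)) : FiniteDimensional ℝ (Semi 𝔞) :=
  haveI : FiniteDimensional ℝ 𝔞 := inferInstanceAs (FiniteDimensional ℝ 𝔞.toSubmodule)
  (LieAlgebra.SemiDirectSum.toProdl 𝔞.incl).symm.finiteDimensional

/-- The inclusion `N → 𝔞 ⊕ N`. -/
abbrev inN (𝔞 : LieSubalgebra ℝ (LieDerivation ℝ N N)) : N →ₗ⁅ℝ⁆ Semi 𝔞 :=
  LieAlgebra.SemiDirectSum.inl 𝔞.incl

/-- The inclusion `𝔞 → 𝔞 ⊕ N`. -/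
abbrev inA (𝔞 : LieSubalgebra ℝ (LieDerivation ℝ N N)) : 𝔞 →ₗ⁅ℝ⁆ Semi 𝔞 :=
  LieAlgebra.SemiDirectSum.inr 𝔞.incl

theorem lie_inA_inN (𝔞 : LieSubalgebra ℝ (LieDerivation ℝ N N)) (A : 𝔞) (X : N) :
    ⁅inA 𝔞 A, inN 𝔞 X⁆ = inN 𝔞 ((A : LieDerivation ℝ N N) X) := by
  simp

variable [FiniteDimensional ℝ N]

theorem trace_sq_pos (g : LieInner N) (A : LieDerivation ℝ N N) (hA : g.IsSymmDer A)
    (h0 : A ≠ 0) : 0 < LinearMap.trace ℝ N ((A : N →ₗ[ℝ] N) ∘ₗ (A : N →ₗ[ℝ] N)) := by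
  let core : InnerProductSpace.Core ℝ N :=
    { inner := fun X Y => g.form X Y
      conj_inner_symm := fun X Y => g.symm Y X
      re_inner_nonneg := fun X => by
        by_cases h : X = 0
        · simp [h]
        · exact (g.pos X h).le
      add_left := fun X Y Z => by simp
      smul_left := fun X Y r => by simp
      definite := fun X h => by
        by_contra hX
        exact (g.pos X hX).ne' h }
  let _ : NormedAddCommGroup N := core.toNormedAddCommGroup
  let _ : InnerProductSpace ℝ N := InnerProductSpace.ofCore core.toCore
  have hin : ∀ X Y : N, inner ℝ X Y = g.form X Y := fun _ _ => rfl
  let b := stdOrthonormalBasis ℝ N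
  rw [LinearMap.trace_eq_sum_inner _ b]
  have hterm : ∀ i, inner ℝ (b i) (((A : N →ₗ[ℝ] N) ∘ₗ (A : N →ₗ[ℝ] N)) (b i))
      = inner ℝ (A (b i)) (A (b i)) := fun i => (hA (b i) (A (b i))).symm
  simp only [hterm]
  have hne : ∃ i, A (b i) ≠ 0 := by
    by_contra! hz
    apply h0
    have : (A : N →ₗ[ℝ] N) = 0 := b.toBasis.ext fun i => by simpa using hz i
    ext X
    exact LinearMap.congr_fun this X
  obtain ⟨i, hi⟩ := hne
  exact Finset.sum_pos' (fun j _ => real_inner_self_nonneg)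
    ⟨i, Finset.mem_univ _, real_inner_self_pos.mpr hi⟩

/-- The bilinear form `(A, B) ↦ tr (A ∘ B)` on derivations. -/
noncomputable def traceForm (𝔞 : LieSubalgebra ℝ (LieDerivation ℝ N N)) :
    LinearMap.BilinForm ℝ 𝔞 :=
  LinearMap.mk₂ ℝ (fun A B => LinearMap.trace ℝ N
      (((A : LieDerivation ℝ N N) : N →ₗ[ℝ] N) ∘ₗ ((B : LieDerivation ℝ N N) : N →ₗ[ℝ] N)))
    (fun A A' B => by rw [← map_add]; congr 1)
    (fun c A B => by rw [← map_smul]; congr 1)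
    (fun A B B' => by
      rw [← map_add]; congr 1; ext Z; simp)
    (fun c A B => by rw [← map_smul]; congr 1; ext Z; simp)

/-- The inner product on `𝔞 ⊕ N` that is `g₁` on `N`, makes `𝔞` and `N` orthogonal and is
`⟨A, B⟩ = -(1/c) tr (A ∘ B)` on `𝔞`. -/
noncomputable def extend (g₁ : LieInner N) (c : ℝ) (hc : c < 0)
    (𝔞 : LieSubalgebra ℝ (LieDerivation ℝ N N)) (h𝔞 : ∀ A ∈ 𝔞, g₁.IsSymmDer A) :
    LieInner (Semi 𝔞) where
  form := g₁.form.compl₁₂ (LieAlgebra.SemiDirectSum.projl 𝔞.incl)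
      (LieAlgebra.SemiDirectSum.projl 𝔞.incl)
    + (-(1 / c)) • (traceForm 𝔞).compl₁₂
      ((LieAlgebra.SemiDirectSum.projr 𝔞.incl : Semi 𝔞 →ₗ⁅ℝ⁆ 𝔞) : Semi 𝔞 →ₗ[ℝ] 𝔞)
      ((LieAlgebra.SemiDirectSum.projr 𝔞.incl : Semi 𝔞 →ₗ⁅ℝ⁆ 𝔞) : Semi 𝔞 →ₗ[ℝ] 𝔞)
  symm := by
    rintro ⟨X, A⟩ ⟨Y, B⟩
    simp only [LinearMap.add_apply, LinearMap.smul_apply, LinearMap.compl₁₂_apply]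
    congr 1
    · exact g₁.symm _ _
    · congr 1
      exact LinearMap.trace_comp_comm' _ _
  pos := by
    rintro ⟨X, A⟩ h
    have hc' : 0 < -(1 / c) := by
      have := one_div_neg.mpr hc
      linarith
    have key : 0 < g₁.form X X + (-(1 / c)) * traceForm 𝔞 A A := by
      have hX : 0 ≤ g₁.form X X := by
        by_cases hX : X = 0
        · simp [hX]
        · exact (g₁.pos X hX).le
      by_cases hA : A = 0
      · subst hA
        have hX0 : X ≠ 0 := by
          rintro rfl
          exact h rfl
        simpa using g₁.pos X hX0
      · have : 0 < traceForm 𝔞 A A :=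
          trace_sq_pos g₁ A (h𝔞 A A.2) (fun h => hA (Subtype.ext h))
        have := mul_pos hc' this
        linarith
    exact key

section

variable (g₁ : LieInner N) (c : ℝ) (hc : c < 0) (𝔞 : LieSubalgebra ℝ (LieDerivation ℝ N N))
  (h𝔞 : ∀ A ∈ 𝔞, g₁.IsSymmDer A)

theorem extend_inN_inN (X Y : N) :
    (g₁.extend c hc 𝔞 h𝔞).form (inN 𝔞 X) (inN 𝔞 Y) = g₁.form X Y := by
  simp [extend]

theorem extend_inA_inN (A : 𝔞) (X : N) :
    (g₁.extend c hc 𝔞 h𝔞).form (inA 𝔞 A) (inN 𝔞 X) = 0 := by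
  simp [extend]

theorem extend_inA_inA (A : 𝔞) :
    (g₁.extend c hc 𝔞 h𝔞).form (inA 𝔞 A) (inA 𝔞 A) =
      -(1 / c) * LinearMap.trace ℝ N (((A : LieDerivation ℝ N N) : N →ₗ[ℝ] N) ∘ₗ
        ((A : LieDerivation ℝ N N) : N →ₗ[ℝ] N)) := by
  simp [extend, traceForm]

end

end Construction

end LieInner

/-! Write `∇.X` for the operator `Z ↦ ∇_Z X`. Everything rests on `ric(X,Y) = -⟨H, ∇_X Y⟩ - tr(∇.X ∘
∇.Y)`. In the semidirect product `∇_A = 0` for `A ∈ 𝔞`, since `𝔞` is abelian and consists of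
symmetric derivations; hence `∇.A = -ad A`. Then `ric(A,B) = -tr(AB) = c⟨A,B⟩`, which is what the
factor `-1/c` is for. The mixed terms vanish by nilpotency of `N`, and on `N` the second fundamental
form turns the `H` term into `Ric₁ - ad H`.

So `Ric = cI + D` with `D = 0` on `𝔞` and `D = D₁ - ad H` on `N`. It is a derivation because `D₁`
and `H` commute with `𝔞`: for `D₁`, `Ric₁` commutes with every symmetric derivation
(`ricci_derivation`).

Clearly `D = 0` forces `D₁ = H`. Conversely, `tr(Ric₁ A) = 0` for symmetric derivations `A`
(`trace_ricci_comp_derivation`) gives `-(1/c) tr(D₁ A) = tr A = ⟨H, A⟩`, so `D₁ ∈ 𝔞` implies `D₁ =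
H`. -/

namespace LieInner

/-! ### Orthonormal traces, transposes and a trace formula for the Ricci form -/

section Metric

variable {L : Type*} [LieRing L] [LieAlgebra ℝ L] (g : LieInner L)

theorem ext_form {X Y : L} (h : ∀ Z, g.form X Z = g.form Y Z) : X = Y := by
  rw [← sub_eq_zero]
  by_contra hne
  exact (g.pos _ hne).ne' (by rw [map_sub g.form, LinearMap.sub_apply, h, sub_self])

variable [FiniteDimensional ℝ L]

theorem exists_orthonormal_basis :
    ∃ b : Module.Basis (Fin (Module.finrank ℝ L)) ℝ L,
      ∀ i j, g.form (b i) (b j) = if i = j then 1 else 0 := by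
  let core : InnerProductSpace.Core ℝ L :=
    { inner := fun X Y => g.form X Y
      conj_inner_symm := fun X Y => g.symm Y X
      re_inner_nonneg := fun X => by
        by_cases h : X = 0
        · simp [h]
        · exact (g.pos X h).le
      add_left := fun X Y Z => by simp
      smul_left := fun X Y r => by simp
      definite := fun X h => by
        by_contra hX
        exact (g.pos X hX).ne' h }
  let _ : NormedAddCommGroup L := core.toNormedAddCommGroup
  let _ : InnerProductSpace ℝ L := InnerProductSpace.ofCore core.toCore
  have hin : ∀ X Y : L, inner ℝ X Y = g.form X Y := fun _ _ => rfl
  let b := stdOrthonormalBasis ℝ L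
  refine ⟨b.toBasis, fun i j => ?_⟩
  rw [← hin, OrthonormalBasis.coe_toBasis]
  exact orthonormal_iff_ite.mp b.orthonormal i j

/-- An orthonormal basis of `L`. -/
noncomputable def basis : Module.Basis (Fin (Module.finrank ℝ L)) ℝ L :=
  g.exists_orthonormal_basis.choose

theorem form_basis (i j : Fin (Module.finrank ℝ L)) :
    g.form (g.basis i) (g.basis j) = if i = j then 1 else 0 :=
  g.exists_orthonormal_basis.choose_spec i j

theorem form_basis_left (i : Fin (Module.finrank ℝ L)) (X : L) :
    g.form (g.basis i) X = g.basis.repr X i := by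
  conv_lhs => rw [← g.basis.sum_repr X]
  simp [form_basis, -Module.Basis.sum_repr]

theorem sum_form_mul_form (X Y : L) :
    ∑ i, g.form (g.basis i) X * g.form (g.basis i) Y = g.form X Y := by
  conv_rhs => rw [← g.basis.sum_repr X]
  simp [form_basis_left, -Module.Basis.sum_repr]

theorem trace_eq_sum (T : Module.End ℝ L) :
    LinearMap.trace ℝ L T = ∑ i, g.form (g.basis i) (T (g.basis i)) := by
  rw [LinearMap.trace_eq_matrix_trace ℝ g.basis, Matrix.trace]
  simp [LinearMap.toMatrix_apply, form_basis_left]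

theorem trace_eq_of_adjoint {S T : Module.End ℝ L}
    (h : ∀ X Y, g.form (S X) Y = g.form X (T Y)) :
    LinearMap.trace ℝ L S = LinearMap.trace ℝ L T := by
  rw [g.trace_eq_sum, g.trace_eq_sum]
  exact Finset.sum_congr rfl fun i _ => by rw [g.symm, h]

theorem trace_eq_zero_of_skew {S : Module.End ℝ L}
    (h : ∀ X Y, g.form (S X) Y = -g.form X (S Y)) : LinearMap.trace ℝ L S = 0 := by
  have := g.trace_eq_of_adjoint (S := S) (T := -S) (fun X Y => by simp [h])
  rw [map_neg] at this
  linarith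

/-- The transpose of an endomorphism. -/
noncomputable def transpose (T : Module.End ℝ L) : Module.End ℝ L :=
  g.riesz ∘ₗ g.form.compl₂ T

theorem form_transpose_left (T : Module.End ℝ L) (X Y : L) :
    g.form (g.transpose T X) Y = g.form X (T Y) := by
  rw [transpose, LinearMap.comp_apply, form_riesz, LinearMap.compl₂_apply]

theorem form_transpose_right (T : Module.End ℝ L) (X Y : L) :
    g.form X (g.transpose T Y) = g.form (T X) Y := by
  rw [g.symm, form_transpose_left, g.symm]

/-- The skew-symmetric operator `J_X` with `⟨J_X Y, Z⟩ = ⟨X, [Y, Z]⟩`. -/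
noncomputable def jMap (X : L) : Module.End ℝ L :=
  g.riesz ∘ₗ (LieAlgebra.ad ℝ L : L →ₗ[ℝ] Module.End ℝ L).compr₂ (g.form X)

theorem form_jMap_left (X Y Z : L) : g.form (g.jMap X Y) Z = g.form X ⁅Y, Z⁆ := by
  rw [jMap, LinearMap.comp_apply, form_riesz]
  simp

theorem form_jMap_right (X Y Z : L) : g.form Y (g.jMap X Z) = -g.form X ⁅Y, Z⁆ := by
  rw [g.symm, form_jMap_left, ← lie_skew, map_neg]

theorem nabla_sub_nabla (X Y : L) : g.nabla X Y - g.nabla Y X = ⁅X, Y⁆ := by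
  refine g.ext_form fun Z => ?_
  have h1 := g.koszul X Y Z
  have h2 := g.koszul Y X Z
  rw [← lie_skew Z X] at h1
  rw [← lie_skew Y X, ← lie_skew Z Y] at h2
  simp only [map_neg, map_sub, LinearMap.neg_apply, LinearMap.sub_apply] at h1 h2 ⊢
  linarith

theorem form_nabla_skew (X Y Z : L) :
    g.form (g.nabla X Y) Z = -g.form Y (g.nabla X Z) := by
  have h1 := g.koszul X Y Z
  have h2 := g.koszul X Z Y
  rw [g.symm Y]
  rw [← lie_skew Z Y, ← lie_skew Y X] at h2
  rw [← lie_skew Z X] at h1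
  simp only [map_neg, LinearMap.neg_apply] at h1 h2
  linarith

theorem nabla_flip_eq_sub (X : L) : g.nabla.flip X = g.nabla X - LieAlgebra.ad ℝ L X := by
  ext Y
  simp [← g.nabla_sub_nabla]

theorem nabla_flip_eq (X : L) : g.nabla.flip X =
    -(1 / 2 : ℝ) • (LieAlgebra.ad ℝ L X + g.transpose (LieAlgebra.ad ℝ L X) + g.jMap X) := by
  ext Y
  refine g.ext_form fun Z => ?_
  have h := g.koszul Y X Z
  rw [← lie_skew Y X, ← lie_skew Z Y] at h
  simp only [map_neg, LinearMap.neg_apply] at h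
  simp only [LinearMap.flip_apply, LinearMap.smul_apply, LinearMap.add_apply, map_smul, map_add,
    form_transpose_left, form_jMap_left, LieAlgebra.ad_apply, smul_eq_mul]
  rw [g.symm Y, g.symm X]
  linarith

theorem trace_nabla (X : L) : LinearMap.trace ℝ L (g.nabla X) = 0 :=
  g.trace_eq_zero_of_skew (g.form_nabla_skew X)

/-- In the trace of `Z ↦ R(Z,X)Y`, the term `∇_Z ∇_X Y` contributes `-tr ad(∇_X Y)`, because `∇_W`
is skew and hence traceless. Cyclicity merges the other two terms through `∇.X = ∇_X - ad X`. -/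
theorem ricciForm_eq (X Y : L) : g.ricciForm X Y =
    -g.form g.meanCurvature (g.nabla X Y)
      - LinearMap.trace ℝ L (g.nabla.flip X ∘ₗ g.nabla.flip Y) := by
  have h : (g.curvature.flip X).flip Y = g.nabla.flip (g.nabla X Y) - g.nabla X ∘ₗ g.nabla.flip Y
      + g.nabla.flip Y ∘ₗ LieAlgebra.ad ℝ L X := by
    ext Z
    simp only [curvature, LinearMap.flip_apply, LinearMap.mk₂_apply, LinearMap.sub_apply,
      LinearMap.comp_apply, LinearMap.add_apply, LieAlgebra.ad_apply]
    rw [← lie_skew X Z, map_neg, LinearMap.neg_apply]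
    abel
  have h2 : g.ricciForm X Y = LinearMap.trace ℝ L ((g.curvature.flip X).flip Y) := rfl
  rw [h2, h, g.nabla_flip_eq_sub X, LinearMap.sub_comp, map_add, map_sub, map_sub,
    LinearMap.trace_comp_comm' _ (LieAlgebra.ad ℝ L X), form_meanCurvature,
    g.nabla_flip_eq_sub (g.nabla X Y), map_sub, trace_nabla]
  ring

theorem form_ricci (X Y : L) : g.form (g.ricci X) Y = g.ricciForm X Y := by
  rw [ricci, LinearMap.comp_apply, form_riesz]

theorem trace_transpose_ad_comp_ad (X Y : L) :
    LinearMap.trace ℝ L (g.transpose (LieAlgebra.ad ℝ L X) ∘ₗ LieAlgebra.ad ℝ L Y)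
      = ∑ j, g.form ⁅X, g.basis j⁆ ⁅Y, g.basis j⁆ := by
  rw [g.trace_eq_sum]
  simp [form_transpose_right]

theorem trace_jMap_comp_jMap (X Y : L) :
    LinearMap.trace ℝ L (g.jMap X ∘ₗ g.jMap Y)
      = -∑ j, ∑ k, g.form X ⁅g.basis j, g.basis k⁆ * g.form Y ⁅g.basis j, g.basis k⁆ := by
  rw [g.trace_eq_sum, ← Finset.sum_neg_distrib]
  refine Finset.sum_congr rfl fun j _ => ?_
  rw [LinearMap.comp_apply, form_jMap_right, ← form_jMap_left, ← g.sum_form_mul_form]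
  simp [g.symm (g.basis _), form_jMap_left]

theorem jMap_derivation {A : LieDerivation ℝ L L} (hA : g.IsSymmDer A) (X : L) :
    g.jMap (A X) = g.jMap X ∘ₗ (A : L →ₗ[ℝ] L) + (A : L →ₗ[ℝ] L) ∘ₗ g.jMap X := by
  ext Y
  refine g.ext_form fun Z => ?_
  simp only [LinearMap.add_apply, LinearMap.comp_apply, LieDerivation.coeFn_coe, map_add, hA _ _,
    form_jMap_left, LieDerivation.apply_lie_eq_add]
  ring

theorem transpose_ad_derivation {A : LieDerivation ℝ L L} (hA : g.IsSymmDer A) (X : L) :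
    g.transpose (LieAlgebra.ad ℝ L (A X)) =
      g.transpose (LieAlgebra.ad ℝ L X) ∘ₗ (A : L →ₗ[ℝ] L)
        - (A : L →ₗ[ℝ] L) ∘ₗ g.transpose (LieAlgebra.ad ℝ L X) := by
  ext Y
  refine g.ext_form fun Z => ?_
  simp only [LinearMap.sub_apply, LinearMap.comp_apply, LieDerivation.coeFn_coe, map_sub, hA _ _,
    form_transpose_left, LieAlgebra.ad_apply, LieDerivation.apply_lie_eq_add, map_add]
  ring

end Metric

/-! ### Ricci curvature of nilpotent algebras and symmetric derivations -/

section Nilpotent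

variable {N : Type*} [LieRing N] [LieAlgebra ℝ N]

theorem derivation_mem_lowerCentralSeries (D : LieDerivation ℝ N N) (k : ℕ) {X : N}
    (hX : X ∈ LieModule.lowerCentralSeries ℝ N N k) :
    D X ∈ LieModule.lowerCentralSeries ℝ N N k := by
  induction k generalizing X with
  | zero => simp
  | succ k ih =>
    rw [LieModule.lowerCentralSeries_succ, ← LieSubmodule.mem_toSubmodule,
      LieSubmodule.lieIdeal_oper_eq_linear_span'] at hX ⊢
    induction hX using Submodule.span_induction with
    | mem X hX =>
      obtain ⟨Y, hY, Z, hZ, rfl⟩ := hX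
      rw [LieDerivation.apply_lie_eq_add]
      exact add_mem (Submodule.subset_span ⟨_, hY, _, ih hZ, rfl⟩)
        (Submodule.subset_span ⟨_, LieSubmodule.mem_top _, _, hZ, rfl⟩)
    | zero => rw [map_zero]; exact zero_mem _
    | add X Y _ _ hX hY => rw [map_add]; exact add_mem hX hY
    | smul r X _ hX => rw [map_smul]; exact Submodule.smul_mem _ r hX

variable [LieRing.IsNilpotent N]

theorem trace_ad_eq_zero (X : N) : LinearMap.trace ℝ N (LieAlgebra.ad ℝ N X) = 0 :=
  (LinearMap.isNilpotent_trace_of_isNilpotent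
    (LieModule.isNilpotent_toEnd_of_isNilpotent ℝ N N X)).eq_zero

theorem trace_ad_comp_ad (X Y : N) :
    LinearMap.trace ℝ N (LieAlgebra.ad ℝ N X ∘ₗ LieAlgebra.ad ℝ N Y) = 0 := by
  have := LinearMap.congr_fun₂ (LieModule.traceForm_eq_zero_of_isNilpotent ℝ N N) X Y
  exact this

/-- `ad X` moves each term of the lower central series into the next and `D` preserves every term,
so the composite is nilpotent. -/
theorem trace_derivation_comp_ad_eq_zero (D : LieDerivation ℝ N N) (X : N) :
    LinearMap.trace ℝ N ((D : N →ₗ[ℝ] N) ∘ₗ LieAlgebra.ad ℝ N X) = 0 := by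
  have hmem : ∀ (k : ℕ) (Y : N), (((D : N →ₗ[ℝ] N) ∘ₗ LieAlgebra.ad ℝ N X) ^ k) Y ∈
      LieModule.lowerCentralSeries ℝ N N k := by
    intro k
    induction k with
    | zero => simp
    | succ k ih =>
      intro Y
      rw [pow_succ', Module.End.mul_apply]
      refine derivation_mem_lowerCentralSeries D _ ?_
      rw [LieModule.lowerCentralSeries_succ]
      exact LieSubmodule.lie_mem_lie (LieSubmodule.mem_top _) (ih Y)
  obtain ⟨k, hk⟩ := LieModule.IsNilpotent.nilpotent ℝ N N
  refine (LinearMap.isNilpotent_trace_of_isNilpotent ⟨k, ?_⟩).eq_zero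
  ext Y
  have := hmem k Y
  rwa [hk, LieSubmodule.mem_bot] at this

variable [FiniteDimensional ℝ N] (g : LieInner N)

theorem meanCurvature_eq_zero : g.meanCurvature = 0 :=
  g.ext_form fun X => by rw [form_meanCurvature, trace_ad_eq_zero, map_zero, LinearMap.zero_apply]

/-- Expand `∇.X = -(1/2)(ad X + (ad X)ᵗ + J_X)`. Here `H = 0`, the terms `ad ad` and `adᵗ adᵗ` are
traceless by nilpotency, and the cross terms with `J` pair the symmetric `ad + adᵗ` with a skew
operator. -/
theorem ricciForm_eq_of_nilpotent (X Y : N) : g.ricciForm X Y =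
    -(1 / 2) * LinearMap.trace ℝ N
      (g.transpose (LieAlgebra.ad ℝ N X) ∘ₗ LieAlgebra.ad ℝ N Y)
    - (1 / 4) * LinearMap.trace ℝ N (g.jMap X ∘ₗ g.jMap Y) := by
  have key : ∀ S T : Module.End ℝ N, LinearMap.trace ℝ N (g.transpose S ∘ₗ g.transpose T)
      = LinearMap.trace ℝ N (T ∘ₗ S) := fun S T =>
    g.trace_eq_of_adjoint fun X Y => by simp [form_transpose_left]
  have h1 := key (LieAlgebra.ad ℝ N X) (LieAlgebra.ad ℝ N Y)
  have h2 : LinearMap.trace ℝ N (LieAlgebra.ad ℝ N X ∘ₗ g.transpose (LieAlgebra.ad ℝ N Y))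
      = LinearMap.trace ℝ N (g.transpose (LieAlgebra.ad ℝ N X) ∘ₗ LieAlgebra.ad ℝ N Y) := by
    rw [LinearMap.trace_comp_comm']
    refine g.trace_eq_of_adjoint fun Z W => ?_
    simp [form_transpose_left, form_transpose_right]
  have hJ : ∀ X Y : N, LinearMap.trace ℝ N (LieAlgebra.ad ℝ N X ∘ₗ g.jMap Y)
      + LinearMap.trace ℝ N (g.transpose (LieAlgebra.ad ℝ N X) ∘ₗ g.jMap Y) = 0 := by
    intro X Y
    rw [LinearMap.trace_comp_comm', ← map_add]
    have : LinearMap.trace ℝ N (g.jMap Y ∘ₗ LieAlgebra.ad ℝ N X)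
        = LinearMap.trace ℝ N (-(g.transpose (LieAlgebra.ad ℝ N X) ∘ₗ g.jMap Y)) :=
      g.trace_eq_of_adjoint fun Z W => by
        simp [form_transpose_right, form_jMap_left, form_jMap_right]
    rw [map_add, this, map_neg]
    ring
  have hJX := hJ X Y
  have hJY := hJ Y X
  rw [LinearMap.trace_comp_comm' (g.jMap X), LinearMap.trace_comp_comm' (g.jMap X)] at hJY
  rw [ricciForm_eq, meanCurvature_eq_zero, nabla_flip_eq, nabla_flip_eq]
  simp only [LinearMap.smul_comp, LinearMap.comp_smul, LinearMap.add_comp, LinearMap.comp_add,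
    map_smul, map_add, map_zero, LinearMap.zero_apply, smul_eq_mul]
  rw [trace_ad_comp_ad, h1, h2, trace_ad_comp_ad]
  linarith

/-- Substituting the formulas for `J_{AX}`, `(ad AX)ᵗ` and `ad AY`, the two sides differ only by
cyclic permutations of `A` under the trace. -/
theorem ricciForm_derivation {A : LieDerivation ℝ N N} (hA : g.IsSymmDer A) (X Y : N) :
    g.ricciForm (A X) Y = g.ricciForm X (A Y) := by
  have had : LieAlgebra.ad ℝ N (A Y) = (A : N →ₗ[ℝ] N) ∘ₗ LieAlgebra.ad ℝ N Y
      - LieAlgebra.ad ℝ N Y ∘ₗ (A : N →ₗ[ℝ] N) := by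
    ext Z
    simp
  have h1 := LinearMap.trace_comp_comm' (A : N →ₗ[ℝ] N)
    (g.transpose (LieAlgebra.ad ℝ N X) ∘ₗ LieAlgebra.ad ℝ N Y)
  have h2 := LinearMap.trace_comp_comm' (A : N →ₗ[ℝ] N) (g.jMap X ∘ₗ g.jMap Y)
  simp only [LinearMap.comp_assoc] at h1 h2
  simp only [ricciForm_eq_of_nilpotent, g.jMap_derivation hA, g.transpose_ad_derivation hA, had,
    LinearMap.sub_comp, LinearMap.comp_sub, LinearMap.add_comp, LinearMap.comp_add, map_sub,
    map_add, LinearMap.comp_assoc]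
  rw [h1, h2]
  ring

theorem ricci_derivation {A : LieDerivation ℝ N N} (hA : g.IsSymmDer A) (X : N) :
    g.ricci (A X) = A (g.ricci X) :=
  g.ext_form fun Z => by rw [hA, form_ricci, form_ricci, g.ricciForm_derivation hA]

/-- The `J` part yields `(1/4) ∑ ⟨A[e_j,e_k], [e_j,e_k]⟩`. By Leibniz and the symmetry `j ↔ k` this
is `(1/2) ∑ ⟨[Ae_j,e_k], [e_j,e_k]⟩`, which cancels the `ad` part. -/
theorem trace_ricci_comp_derivation {A : LieDerivation ℝ N N} (hA : g.IsSymmDer A) :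
    LinearMap.trace ℝ N (g.ricci ∘ₗ (A : N →ₗ[ℝ] N)) = 0 := by
  have h1 : ∑ i, LinearMap.trace ℝ N (g.jMap (A (g.basis i)) ∘ₗ g.jMap (g.basis i)) =
      -∑ j, ∑ k, g.form (A ⁅g.basis j, g.basis k⁆) ⁅g.basis j, g.basis k⁆ := by
    simp only [trace_jMap_comp_jMap, Finset.sum_neg_distrib, hA (g.basis _)]
    rw [Finset.sum_comm]
    congr 1
    refine Finset.sum_congr rfl fun j _ => ?_
    rw [Finset.sum_comm]
    exact Finset.sum_congr rfl fun k _ => g.sum_form_mul_form _ _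
  have h2 : ∑ j, ∑ k, g.form ⁅g.basis j, A (g.basis k)⁆ ⁅g.basis j, g.basis k⁆ =
      ∑ j, ∑ k, g.form ⁅A (g.basis j), g.basis k⁆ ⁅g.basis j, g.basis k⁆ := by
    rw [Finset.sum_comm]
    refine Finset.sum_congr rfl fun j _ => Finset.sum_congr rfl fun k _ => ?_
    rw [← lie_skew (g.basis k) (A (g.basis j)), ← lie_skew (g.basis k) (g.basis j)]
    simp only [map_neg, LinearMap.neg_apply, neg_neg]
  simp only [LieDerivation.apply_lie_eq_add, map_add, LinearMap.add_apply,
    Finset.sum_add_distrib, h2] at h1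
  rw [g.trace_eq_sum]
  simp only [LinearMap.comp_apply, LieDerivation.coeFn_coe, g.symm (g.basis _) (g.ricci _),
    form_ricci, ricciForm_eq_of_nilpotent, Finset.sum_sub_distrib, ← Finset.mul_sum,
    trace_transpose_ad_comp_ad]
  rw [h1]
  ring

end Nilpotent

end LieInner

namespace LieInner

/-! ### Connection and Ricci operator of the semidirect product -/

section Semidirect

open LieAlgebra.SemiDirectSum

variable {N : Type*} [LieRing N] [LieAlgebra ℝ N] (𝔞 : LieSubalgebra ℝ (LieDerivation ℝ N N))

theorem isSolvable_semi [LieRing.IsNilpotent N] (hab : IsLieAbelian 𝔞) :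
    LieAlgebra.IsSolvable (Semi 𝔞) := by
  -- This ideal is a copy of `N`, hence solvable, and it contains `[𝔰, 𝔰]` because `𝔞` is abelian.
  -- The derived length grows by at most one.
  let I : LieIdeal ℝ (Semi 𝔞) := (projr 𝔞.incl).ker
  have hI : ∀ X : Semi 𝔞, X ∈ I ↔ X.right = 0 := fun X => by simp [I]
  let f : I →ₗ⁅ℝ⁆ N :=
    { projl 𝔞.incl ∘ₗ I.toSubmodule.subtype with
      map_lie' := by
        rintro ⟨X, hX⟩ ⟨Y, hY⟩
        rw [hI] at hX hY
        simp [hX, hY] }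
  have hf : Function.Injective f := by
    rintro ⟨X, hX⟩ ⟨Y, hY⟩ h
    refine Subtype.ext (LieAlgebra.SemiDirectSum.ext h ?_)
    exact ((hI X).mp hX).trans ((hI Y).mp hY).symm
  obtain ⟨k, hk⟩ := (hf.lieAlgebra_isSolvable : LieAlgebra.IsSolvable I).solvable ℝ
  rw [LieIdeal.derivedSeries_eq_bot_iff] at hk
  refine LieAlgebra.IsSolvable.mk (R := ℝ) (k := k + 1) ?_
  rw [LieAlgebra.derivedSeries_def, LieAlgebra.derivedSeriesOfIdeal_add, eq_bot_iff, ← hk]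
  refine LieAlgebra.derivedSeriesOfIdeal_mono ?_ k
  rw [LieAlgebra.derivedSeriesOfIdeal_succ, LieSubmodule.lie_le_iff]
  intro X _ Y _
  rw [hI, lie_eq_mk]
  exact trivial_lie_zero _ _ _ _

variable {𝔞}

theorem eq_inN_add_inA (W : Semi 𝔞) : W = inN 𝔞 W.left + inA 𝔞 W.right := by simp

theorem linearMap_semi_ext {M : Type*} [AddCommGroup M] [Module ℝ M] {S T : Semi 𝔞 →ₗ[ℝ] M}
    (hN : ∀ X, S (inN 𝔞 X) = T (inN 𝔞 X)) (hA : ∀ A, S (inA 𝔞 A) = T (inA 𝔞 A)) : S = T := by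
  refine LinearMap.ext fun W => ?_
  rw [eq_inN_add_inA W, map_add, map_add, hN, hA]

variable [FiniteDimensional ℝ N]

theorem trace_semi (T : Module.End ℝ (Semi 𝔞)) :
    LinearMap.trace ℝ (Semi 𝔞) T =
      LinearMap.trace ℝ N (projl 𝔞.incl ∘ₗ T ∘ₗ (inN 𝔞 : N →ₗ[ℝ] Semi 𝔞))
      + LinearMap.trace ℝ 𝔞 ((projr 𝔞.incl : Semi 𝔞 →ₗ[ℝ] 𝔞) ∘ₗ T ∘ₗ
          (inA 𝔞 : 𝔞 →ₗ[ℝ] Semi 𝔞)) := by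
  have : FiniteDimensional ℝ 𝔞 := inferInstanceAs (FiniteDimensional ℝ 𝔞.toSubmodule)
  rw [LinearMap.trace_comp_comm', LinearMap.trace_comp_comm' (T ∘ₗ _), ← map_add]
  congr 1
  rw [LinearMap.comp_assoc, LinearMap.comp_assoc, ← LinearMap.comp_add]
  ext W
  · simp
  · simp

variable {g₁ : LieInner N} {c : ℝ} {hc : c < 0} {hsymm : ∀ A ∈ 𝔞, g₁.IsSymmDer A}

theorem extend_apply (V W : Semi 𝔞) : (g₁.extend c hc 𝔞 hsymm).form V W =
    g₁.form V.left W.left - 1 / c * traceForm 𝔞 V.right W.right := by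
  simp [extend]
  ring

theorem left_eq_of_form {W : Semi 𝔞} {X : N}
    (h : ∀ Z, (g₁.extend c hc 𝔞 hsymm).form W (inN 𝔞 Z) = g₁.form X Z) : W.left = X :=
  g₁.ext_form fun Z => by rw [← h, extend_apply]; simp

/-- In the Koszul formula `⟨[W,Z], A⟩` vanishes, since brackets have no `𝔞`-component, and the other
two terms cancel by the symmetry of `A`. -/
theorem nabla_inA (hab : IsLieAbelian 𝔞) (A : 𝔞) (W : Semi 𝔞) :
    (g₁.extend c hc 𝔞 hsymm).nabla (inA 𝔞 A) W = 0 := by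
  refine (g₁.extend c hc 𝔞 hsymm).ext_form fun Z => ?_
  have h := (g₁.extend c hc 𝔞 hsymm).koszul (inA 𝔞 A) W Z
  have h0 : ∀ B C : 𝔞, ⁅B, C⁆ = 0 := fun B C => trivial_lie_zero _ _ _ _
  have hs := hsymm A A.2 W.left Z.left
  simp only [extend_apply, lie_eq_mk, inr_eq_mk, h0, map_zero, LinearMap.zero_apply] at h ⊢
  simp [hs] at h
  rw [g₁.symm _ W.left] at h
  simpa using h

theorem nabla_inN_inN_left (X Y : N) :
    ((g₁.extend c hc 𝔞 hsymm).nabla (inN 𝔞 X) (inN 𝔞 Y)).left = g₁.nabla X Y := by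
  refine left_eq_of_form (hc := hc) (hsymm := hsymm) fun Z => ?_
  have h := (g₁.extend c hc 𝔞 hsymm).koszul (inN 𝔞 X) (inN 𝔞 Y) (inN 𝔞 Z)
  have h1 := g₁.koszul X Y Z
  rw [← LieHom.map_lie, ← LieHom.map_lie, ← LieHom.map_lie, extend_inN_inN, extend_inN_inN,
    extend_inN_inN] at h
  linarith

theorem nabla_inN_inA (hab : IsLieAbelian 𝔞) (X : N) (A : 𝔞) :
    (g₁.extend c hc 𝔞 hsymm).nabla (inN 𝔞 X) (inA 𝔞 A)
      = -inN 𝔞 ((A : LieDerivation ℝ N N) X) := by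
  have h := (g₁.extend c hc 𝔞 hsymm).nabla_sub_nabla (inN 𝔞 X) (inA 𝔞 A)
  rwa [nabla_inA hab, sub_zero, ← lie_skew, lie_inA_inN] at h

theorem form_inA_nabla_inN_inN (hab : IsLieAbelian 𝔞) (X Y : N) (A : 𝔞) :
    (g₁.extend c hc 𝔞 hsymm).form (inA 𝔞 A)
      ((g₁.extend c hc 𝔞 hsymm).nabla (inN 𝔞 X) (inN 𝔞 Y))
      = g₁.form ((A : LieDerivation ℝ N N) X) Y := by
  have h := (g₁.extend c hc 𝔞 hsymm).form_nabla_skew (inN 𝔞 X) (inA 𝔞 A) (inN 𝔞 Y)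
  rw [nabla_inN_inA hab, map_neg, LinearMap.neg_apply, extend_inN_inN] at h
  linarith

theorem meanCurvature_extend_left [LieRing.IsNilpotent N] :
    (g₁.extend c hc 𝔞 hsymm).meanCurvature.left = 0 := by
  refine left_eq_of_form (hc := hc) (hsymm := hsymm) fun X => ?_
  rw [form_meanCurvature, trace_semi, map_zero, LinearMap.zero_apply]
  have h1 : projl 𝔞.incl ∘ₗ LieAlgebra.ad ℝ (Semi 𝔞) (inN 𝔞 X) ∘ₗ (inN 𝔞 : N →ₗ[ℝ] Semi 𝔞)
      = LieAlgebra.ad ℝ N X := by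
    ext Y; simp
  have h2 : (projr 𝔞.incl : Semi 𝔞 →ₗ[ℝ] 𝔞) ∘ₗ LieAlgebra.ad ℝ (Semi 𝔞) (inN 𝔞 X) ∘ₗ
      (inA 𝔞 : 𝔞 →ₗ[ℝ] Semi 𝔞) = 0 := by
    ext B; simp
  rw [h1, h2, trace_ad_eq_zero, map_zero, add_zero]

theorem inA_meanCurvature_right [LieRing.IsNilpotent N] :
    inA 𝔞 (g₁.extend c hc 𝔞 hsymm).meanCurvature.right
      = (g₁.extend c hc 𝔞 hsymm).meanCurvature :=
  LieAlgebra.SemiDirectSum.ext (meanCurvature_extend_left).symm rfl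

theorem trace_ad_inA (hab : IsLieAbelian 𝔞) (A : 𝔞) :
    LinearMap.trace ℝ (Semi 𝔞) (LieAlgebra.ad ℝ (Semi 𝔞) (inA 𝔞 A))
      = LinearMap.trace ℝ N ((A : LieDerivation ℝ N N) : N →ₗ[ℝ] N) := by
  have h0 : ∀ B C : 𝔞, ⁅B, C⁆ = 0 := fun B C => trivial_lie_zero _ _ _ _
  have h1 : projl 𝔞.incl ∘ₗ LieAlgebra.ad ℝ (Semi 𝔞) (inA 𝔞 A) ∘ₗ (inN 𝔞 : N →ₗ[ℝ] Semi 𝔞)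
      = ((A : LieDerivation ℝ N N) : N →ₗ[ℝ] N) := by
    ext Y; simp
  have h2 : (projr 𝔞.incl : Semi 𝔞 →ₗ[ℝ] 𝔞) ∘ₗ LieAlgebra.ad ℝ (Semi 𝔞) (inA 𝔞 A) ∘ₗ
      (inA 𝔞 : 𝔞 →ₗ[ℝ] Semi 𝔞) = 0 := by
    refine LinearMap.ext fun B => ?_
    simp [h0]
  rw [trace_semi, h1, h2, map_zero, add_zero]

theorem nabla_flip_inA (hab : IsLieAbelian 𝔞) (A : 𝔞) :
    (g₁.extend c hc 𝔞 hsymm).nabla.flip (inA 𝔞 A) = -LieAlgebra.ad ℝ (Semi 𝔞) (inA 𝔞 A) := by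
  have h : (g₁.extend c hc 𝔞 hsymm).nabla (inA 𝔞 A) = 0 := LinearMap.ext (nabla_inA hab A)
  rw [nabla_flip_eq_sub, h, zero_sub]

theorem ricciForm_inA_inA (hab : IsLieAbelian 𝔞) (A B : 𝔞) :
    (g₁.extend c hc 𝔞 hsymm).ricciForm (inA 𝔞 A) (inA 𝔞 B) = -traceForm 𝔞 A B := by
  have h0 : ∀ B C : 𝔞, ⁅B, C⁆ = 0 := fun B C => trivial_lie_zero _ _ _ _
  rw [ricciForm_eq, nabla_inA hab, map_zero, nabla_flip_inA hab, nabla_flip_inA hab, trace_semi]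
  have h1 : projl 𝔞.incl ∘ₗ ((-LieAlgebra.ad ℝ (Semi 𝔞) (inA 𝔞 A)) ∘ₗ
      (-LieAlgebra.ad ℝ (Semi 𝔞) (inA 𝔞 B))) ∘ₗ (inN 𝔞 : N →ₗ[ℝ] Semi 𝔞)
      = ((A : LieDerivation ℝ N N) : N →ₗ[ℝ] N) ∘ₗ ((B : LieDerivation ℝ N N) : N →ₗ[ℝ] N) := by
    ext Y; simp
  have h2 : (projr 𝔞.incl : Semi 𝔞 →ₗ[ℝ] 𝔞) ∘ₗ ((-LieAlgebra.ad ℝ (Semi 𝔞) (inA 𝔞 A)) ∘ₗ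
      (-LieAlgebra.ad ℝ (Semi 𝔞) (inA 𝔞 B))) ∘ₗ (inA 𝔞 : 𝔞 →ₗ[ℝ] Semi 𝔞) = 0 := by
    refine LinearMap.ext fun C => ?_
    simp [h0]
  rw [h1, h2, map_zero, neg_zero, zero_sub, add_zero]
  rfl

/-- Since `∇_A = 0`, the operator `∇.Y` kills `𝔞`, and only the `N`-block contributes. -/
theorem trace_nabla_flip_inN_comp (T : Module.End ℝ (Semi 𝔞)) (hab : IsLieAbelian 𝔞) (Y : N) :
    LinearMap.trace ℝ (Semi 𝔞) (T ∘ₗ (g₁.extend c hc 𝔞 hsymm).nabla.flip (inN 𝔞 Y)) =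
      LinearMap.trace ℝ N (projl 𝔞.incl ∘ₗ (T ∘ₗ
        (g₁.extend c hc 𝔞 hsymm).nabla.flip (inN 𝔞 Y)) ∘ₗ (inN 𝔞 : N →ₗ[ℝ] Semi 𝔞)) := by
  have h : (projr 𝔞.incl : Semi 𝔞 →ₗ[ℝ] 𝔞) ∘ₗ (T ∘ₗ
      (g₁.extend c hc 𝔞 hsymm).nabla.flip (inN 𝔞 Y)) ∘ₗ (inA 𝔞 : 𝔞 →ₗ[ℝ] Semi 𝔞) = 0 := by
    refine LinearMap.ext fun C => ?_
    simp only [LinearMap.comp_apply, LinearMap.flip_apply, LieHom.coe_toLinearMap,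
      nabla_inA hab, map_zero, LinearMap.zero_apply]
  rw [trace_semi, h, map_zero, add_zero]

variable [LieRing.IsNilpotent N]

/-- Split `∇.Y = ∇_Y - ad Y`: the first part is skew against the symmetric `A`, the second is
covered by nilpotency. This is what kills the mixed Ricci terms. -/
theorem trace_derivation_comp_nabla_flip {A : LieDerivation ℝ N N} (hA : g₁.IsSymmDer A) (Y : N) :
    LinearMap.trace ℝ N ((A : N →ₗ[ℝ] N) ∘ₗ g₁.nabla.flip Y) = 0 := by
  rw [nabla_flip_eq_sub, LinearMap.comp_sub, map_sub, trace_derivation_comp_ad_eq_zero, sub_zero]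
  have h := g₁.trace_eq_of_adjoint (S := (A : N →ₗ[ℝ] N) ∘ₗ g₁.nabla Y)
    (T := -(g₁.nabla Y ∘ₗ (A : N →ₗ[ℝ] N))) fun Z W => by
      simp [hA _ _, form_nabla_skew]
  rw [map_neg, LinearMap.trace_comp_comm'] at h
  rw [LinearMap.trace_comp_comm']
  linarith

theorem trace_nabla_flip_inA_comp_inN (hab : IsLieAbelian 𝔞) (A : 𝔞) (Y : N) :
    LinearMap.trace ℝ (Semi 𝔞) ((g₁.extend c hc 𝔞 hsymm).nabla.flip (inA 𝔞 A) ∘ₗ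
      (g₁.extend c hc 𝔞 hsymm).nabla.flip (inN 𝔞 Y)) = 0 := by
  rw [trace_nabla_flip_inN_comp _ hab, nabla_flip_inA hab]
  have h : projl 𝔞.incl ∘ₗ ((-LieAlgebra.ad ℝ (Semi 𝔞) (inA 𝔞 A)) ∘ₗ
      (g₁.extend c hc 𝔞 hsymm).nabla.flip (inN 𝔞 Y)) ∘ₗ (inN 𝔞 : N →ₗ[ℝ] Semi 𝔞)
      = -(((A : LieDerivation ℝ N N) : N →ₗ[ℝ] N) ∘ₗ g₁.nabla.flip Y) := by
    refine LinearMap.ext fun Z => ?_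
    simp [← nabla_inN_inN_left (hc := hc) (hsymm := hsymm)]
  rw [h, map_neg, trace_derivation_comp_nabla_flip (hsymm A A.2), neg_zero]

theorem ricciForm_inA_inN (hab : IsLieAbelian 𝔞) (A : 𝔞) (Y : N) :
    (g₁.extend c hc 𝔞 hsymm).ricciForm (inA 𝔞 A) (inN 𝔞 Y) = 0 := by
  rw [ricciForm_eq, nabla_inA hab, map_zero, trace_nabla_flip_inA_comp_inN hab, neg_zero, sub_zero]

theorem ricciForm_inN_inA (hab : IsLieAbelian 𝔞) (X : N) (A : 𝔞) :
    (g₁.extend c hc 𝔞 hsymm).ricciForm (inN 𝔞 X) (inA 𝔞 A) = 0 := by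
  rw [ricciForm_eq, nabla_inN_inA hab, map_neg, ← inA_meanCurvature_right, extend_inA_inN,
    LinearMap.trace_comp_comm', trace_nabla_flip_inA_comp_inN hab, neg_zero, neg_zero, sub_zero]

theorem ricciForm_inN_inN (hab : IsLieAbelian 𝔞) (X Y : N) :
    (g₁.extend c hc 𝔞 hsymm).ricciForm (inN 𝔞 X) (inN 𝔞 Y) = g₁.ricciForm X Y
      - g₁.form (((g₁.extend c hc 𝔞 hsymm).meanCurvature.right : LieDerivation ℝ N N) X) Y := by
  rw [ricciForm_eq, ← inA_meanCurvature_right, form_inA_nabla_inN_inN hab,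
    trace_nabla_flip_inN_comp _ hab, ricciForm_eq, g₁.meanCurvature_eq_zero, map_zero,
    LinearMap.zero_apply]
  have h : projl 𝔞.incl ∘ₗ ((g₁.extend c hc 𝔞 hsymm).nabla.flip (inN 𝔞 X) ∘ₗ
      (g₁.extend c hc 𝔞 hsymm).nabla.flip (inN 𝔞 Y)) ∘ₗ (inN 𝔞 : N →ₗ[ℝ] Semi 𝔞)
      = g₁.nabla.flip X ∘ₗ g₁.nabla.flip Y := by
    refine LinearMap.ext fun Z => ?_
    simp only [LinearMap.comp_apply, LinearMap.flip_apply, LieHom.coe_toLinearMap, projl_mk]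
    -- The `𝔞`-component of `∇_Z Y` is invisible to `∇.X`, so the `N`-block of the product is the
    -- product of the `N`-blocks.
    rw [eq_inN_add_inA ((g₁.extend c hc 𝔞 hsymm).nabla (inN 𝔞 Z) (inN 𝔞 Y)), map_add,
      LinearMap.add_apply, nabla_inA hab, add_zero, nabla_inN_inN_left, nabla_inN_inN_left]
  rw [h, inA_meanCurvature_right]
  simp
  ring

theorem ricci_inA (hab : IsLieAbelian 𝔞) (A : 𝔞) :
    (g₁.extend c hc 𝔞 hsymm).ricci (inA 𝔞 A) = c • inA 𝔞 A := by
  refine (g₁.extend c hc 𝔞 hsymm).ext_form fun Z => ?_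
  rw [form_ricci, eq_inN_add_inA Z, map_add, ricciForm_inA_inN hab, ricciForm_inA_inA hab,
    map_smul, LinearMap.smul_apply, map_add, extend_inA_inN, extend_apply (inA 𝔞 A)]
  simp
  field_simp [hc.ne]

theorem ricci_inN (hab : IsLieAbelian 𝔞) (X : N) :
    (g₁.extend c hc 𝔞 hsymm).ricci (inN 𝔞 X) = inN 𝔞 (g₁.ricci X
      - ((g₁.extend c hc 𝔞 hsymm).meanCurvature.right : LieDerivation ℝ N N) X) := by
  refine (g₁.extend c hc 𝔞 hsymm).ext_form fun Z => ?_
  rw [form_ricci, eq_inN_add_inA Z, map_add, ricciForm_inN_inA hab, ricciForm_inN_inN hab,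
    map_add, extend_inN_inN, symm _ _ (inA 𝔞 _), extend_inA_inN, map_sub, LinearMap.sub_apply,
    form_ricci]

end Semidirect

end LieInner

namespace LieInner

/-! ### The nilsoliton condition and the Einstein criterion -/

section Nilsoliton

open LieAlgebra.SemiDirectSum

variable {N : Type*} [LieRing N] [LieAlgebra ℝ N] {𝔞 : LieSubalgebra ℝ (LieDerivation ℝ N N)}

/-- A derivation of `N` that commutes with `𝔞` extends by zero to a derivation of `𝔞 ⊕ N`. -/
def extendDerivation (E : LieDerivation ℝ N N)
    (hE : ∀ (A : 𝔞) (X : N), E ((A : LieDerivation ℝ N N) X) = (A : LieDerivation ℝ N N) (E X)) :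
    LieDerivation ℝ (Semi 𝔞) (Semi 𝔞) where
  toLinearMap := (inN 𝔞 : N →ₗ[ℝ] Semi 𝔞) ∘ₗ (E : N →ₗ[ℝ] N) ∘ₗ projl 𝔞.incl
  leibniz' V W := by
    simp [hE]
    abel

variable [FiniteDimensional ℝ N] [LieRing.IsNilpotent N] {g₁ : LieInner N} {c : ℝ}
  {D₁ : LieDerivation ℝ N N}

theorem nilsoliton_derivation_comm (hRic : g₁.ricci = c • LinearMap.id + (D₁ : N →ₗ[ℝ] N))
    {A : LieDerivation ℝ N N} (hA : g₁.IsSymmDer A) (X : N) : D₁ (A X) = A (D₁ X) := by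
  simpa [hRic] using g₁.ricci_derivation hA X

theorem nilsoliton_trace (hRic : g₁.ricci = c • LinearMap.id + (D₁ : N →ₗ[ℝ] N))
    {A : LieDerivation ℝ N N} (hA : g₁.IsSymmDer A) :
    c * LinearMap.trace ℝ N (A : N →ₗ[ℝ] N)
      + LinearMap.trace ℝ N ((D₁ : N →ₗ[ℝ] N) ∘ₗ (A : N →ₗ[ℝ] N)) = 0 := by
  have h := g₁.trace_ricci_comp_derivation hA
  rwa [hRic, LinearMap.add_comp, LinearMap.smul_comp, LinearMap.id_comp, map_add, map_smul,
    smul_eq_mul] at h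

variable {hc : c < 0} {hsymm : ∀ A ∈ 𝔞, g₁.IsSymmDer A}

/-- Against `A ∈ 𝔞`, `H` gives `tr A` and `D₁` gives `-(1/c) tr(D₁ A)`; these agree by
`nilsoliton_trace`. -/
theorem meanCurvature_eq_of_mem (hRic : g₁.ricci = c • LinearMap.id + (D₁ : N →ₗ[ℝ] N))
    (hab : IsLieAbelian 𝔞) (hD : D₁ ∈ 𝔞) :
    (g₁.extend c hc 𝔞 hsymm).meanCurvature = inA 𝔞 ⟨D₁, hD⟩ := by
  refine (g₁.extend c hc 𝔞 hsymm).ext_form fun W => ?_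
  rw [eq_inN_add_inA W, map_add, map_add, extend_inA_inN, ← inA_meanCurvature_right,
    extend_inA_inN, inA_meanCurvature_right, form_meanCurvature, trace_ad_inA hab, extend_apply]
  have h := nilsoliton_trace hRic (hsymm _ W.right.2)
  have h2 : traceForm 𝔞 ⟨D₁, hD⟩ W.right = LinearMap.trace ℝ N
    ((D₁ : N →ₗ[ℝ] N) ∘ₗ ((W.right : LieDerivation ℝ N N) : N →ₗ[ℝ] N)) := rfl
  simp only [inr_eq_mk, map_zero, h2]
  have := hc.ne
  field_simp
  linarith

theorem ricci_extend_eq_iff (hRic : g₁.ricci = c • LinearMap.id + (D₁ : N →ₗ[ℝ] N))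
    (hab : IsLieAbelian 𝔞) :
    (g₁.extend c hc 𝔞 hsymm).ricci = c • LinearMap.id ↔ D₁ ∈ 𝔞 := by
  constructor
  · intro h
    have hD : D₁ = (g₁.extend c hc 𝔞 hsymm).meanCurvature.right := by
      ext X
      have hX := LinearMap.congr_fun h (inN 𝔞 X)
      rw [ricci_inN hab, LinearMap.smul_apply, LinearMap.id_apply, ← map_smul (inN 𝔞)] at hX
      have := inl_injective _ hX
      rw [hRic] at this
      simpa [add_sub_assoc, sub_eq_zero] using this
    rw [hD]
    exact SetLike.coe_mem _
  · intro hD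
    refine linearMap_semi_ext (fun X => ?_) (fun A => ricci_inA hab A)
    rw [ricci_inN hab, meanCurvature_eq_of_mem hRic hab hD, hRic]
    simp

/-- The point is that `k = c`. In the excluded case `Ric = 0`, so `k = 0` while `D₁ = -cI` is not in
`𝔞 = 0`. -/
theorem isEinstein_extend_iff (hRic : g₁.ricci = c • LinearMap.id + (D₁ : N →ₗ[ℝ] N))
    (hab : IsLieAbelian 𝔞) (hne : ¬(𝔞 = ⊥ ∧ IsLieAbelian N ∧ Nontrivial N)) :
    (g₁.extend c hc 𝔞 hsymm).IsEinstein ↔ D₁ ∈ 𝔞 := by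
  refine ⟨fun ⟨k, hk⟩ => ?_, fun hD => ⟨c, (ricci_extend_eq_iff hRic hab).mpr hD⟩⟩
  by_cases hbot : 𝔞 = ⊥
  · have hzero : ∀ A : 𝔞, (A : LieDerivation ℝ N N) = 0 := fun A => by
      simpa [hbot] using A.2
    have hD : ∀ X, D₁ X = (k - c) • X := by
      intro X
      have hX := LinearMap.congr_fun hk (inN 𝔞 X)
      rw [ricci_inN hab, LinearMap.smul_apply, LinearMap.id_apply, ← map_smul (inN 𝔞), hzero] at hX
      have := inl_injective _ hX
      rw [hRic] at this
      rw [sub_smul, ← this]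
      simp
    suffices D₁ = 0 by rw [this]; exact zero_mem _
    by_cases hN : IsLieAbelian N
    · have : ¬Nontrivial N := fun h => hne ⟨hbot, hN, h⟩
      rw [not_nontrivial_iff_subsingleton] at this
      ext X
      exact Subsingleton.elim _ _
    -- A scalar `λI` is a derivation only if `λ[X,Y] = 2λ[X,Y]`, so a nonzero `λ` makes `N` abelian.
    · have hkc : k - c = 0 := by
        by_contra hkc
        refine hN ⟨fun X Y => ?_⟩
        have h := D₁.apply_lie_eq_add X Y
        rw [hD, hD, hD, lie_smul, smul_lie, left_eq_add] at h
        exact (smul_eq_zero.mp h).resolve_left hkc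
      ext X
      rw [hD, hkc, zero_smul, LieDerivation.zero_apply]
  · obtain ⟨A, hA, hA0⟩ := 𝔞.toSubmodule.ne_bot_iff.mp
      fun h => hbot (LieSubalgebra.toSubmodule_injective h)
    -- `Ric` acts as `c` on the nonzero vector `A` of `𝔞`.
    have hkc : c = k := by
      have h := LinearMap.congr_fun hk (inA 𝔞 ⟨A, hA⟩)
      rw [ricci_inA hab, LinearMap.smul_apply, LinearMap.id_apply] at h
      refine smul_left_injective ℝ (fun h0 => hA0 ?_) h
      simpa using congrArg (fun W : Semi 𝔞 => (W.right : LieDerivation ℝ N N)) h0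
    exact (ricci_extend_eq_iff hRic hab).mp (hk.trans (by rw [hkc]))

end Nilsoliton

end LieInner

theorem proposition4p1 {N : Type*} [LieRing N] [LieAlgebra ℝ N] [FiniteDimensional ℝ N]
    [LieRing.IsNilpotent N] (g₁ : LieInner N) (c : ℝ) (hc : c < 0) (D₁ : LieDerivation ℝ N N)
    (hRic : g₁.ricci = c • LinearMap.id + (D₁ : N →ₗ[ℝ] N))
    (𝔞 : LieSubalgebra ℝ (LieDerivation ℝ N N)) (hab : IsLieAbelian 𝔞)
    (hsymm : ∀ A ∈ 𝔞, g₁.IsSymmDer A)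
    (g : LieInner (LieInner.Semi 𝔞)) (hg : g = g₁.extend c hc 𝔞 hsymm) :
    g.IsSolsoliton ∧
    (∃ (H : 𝔞) (D : LieDerivation ℝ (LieInner.Semi 𝔞) (LieInner.Semi 𝔞)),
      LieInner.inA 𝔞 H = g.meanCurvature ∧
      g.ricci = c • LinearMap.id + (D : LieInner.Semi 𝔞 →ₗ[ℝ] LieInner.Semi 𝔞) ∧
      (∀ A : 𝔞, D (LieInner.inA 𝔞 A) = 0) ∧
      (∀ X : N, D (LieInner.inN 𝔞 X) =
        LieInner.inN 𝔞 (D₁ X) - ⁅g.meanCurvature, LieInner.inN 𝔞 X⁆)) ∧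
    (g.ricci = c • LinearMap.id ↔ D₁ ∈ 𝔞) ∧
    (¬ (𝔞 = ⊥ ∧ IsLieAbelian N ∧ Nontrivial N) → (g.IsEinstein ↔ D₁ ∈ 𝔞)) := by
  subst hg
  set H := (g₁.extend c hc 𝔞 hsymm).meanCurvature.right
  have hinH : LieInner.inA 𝔞 H = (g₁.extend c hc 𝔞 hsymm).meanCurvature :=
    LieInner.inA_meanCurvature_right
  -- Commuting with `𝔞` is what lets `D₁ - H` extend by zero: `H` commutes because it lies in the
  -- abelian `𝔞`, `D₁` because `Ric₁` does.
  have hcomm : ∀ (A : 𝔞) (X : N), (D₁ - (H : LieDerivation ℝ N N)) ((A : LieDerivation ℝ N N) X)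
      = (A : LieDerivation ℝ N N) ((D₁ - (H : LieDerivation ℝ N N)) X) := by
    intro A X
    have h : ⁅H, A⁆ = 0 := trivial_lie_zero _ _ _ _
    have h2 := LieDerivation.congr_fun (congrArg Subtype.val h) X
    rw [LieSubalgebra.coe_bracket, LieDerivation.lie_apply] at h2
    rw [LieDerivation.sub_apply, LieDerivation.sub_apply, map_sub,
      LieInner.nilsoliton_derivation_comm hRic (hsymm A A.2), sub_eq_zero.mp h2]
  let D := LieInner.extendDerivation (D₁ - (H : LieDerivation ℝ N N)) hcomm
  have hDA : ∀ A : 𝔞, D (LieInner.inA 𝔞 A) = 0 := fun A =>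
    ((LieInner.inN 𝔞 : N →ₗ[ℝ] LieInner.Semi 𝔞) ∘ₗ
      ((D₁ - H : LieDerivation ℝ N N) : N →ₗ[ℝ] N)).map_zero
  have hDN : ∀ X : N, D (LieInner.inN 𝔞 X) =
      LieInner.inN 𝔞 ((D₁ - (H : LieDerivation ℝ N N)) X) := fun _ => rfl
  have hricci : (g₁.extend c hc 𝔞 hsymm).ricci
      = c • LinearMap.id + (D : LieInner.Semi 𝔞 →ₗ[ℝ] LieInner.Semi 𝔞) := by
    refine LieInner.linearMap_semi_ext (fun X => ?_) (fun A => ?_)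
    · rw [LieInner.ricci_inN hab, LinearMap.add_apply, LinearMap.smul_apply, LinearMap.id_apply,
        LieDerivation.coeFn_coe, hDN, hRic, ← map_smul (LieInner.inN 𝔞),
        ← map_add (LieInner.inN 𝔞)]
      congr 1
      exact add_sub_assoc _ _ _
    · rw [LieInner.ricci_inA hab, LinearMap.add_apply, LinearMap.smul_apply, LinearMap.id_apply,
        LieDerivation.coeFn_coe, hDA, add_zero]
  refine ⟨⟨LieInner.isSolvable_semi 𝔞 hab, c, D, hricci⟩, ⟨H, D, hinH, hricci, hDA, fun X => ?_⟩,
    LieInner.ricci_extend_eq_iff hRic hab, LieInner.isEinstein_extend_iff hRic hab⟩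
  rw [hDN, ← hinH, LieInner.lie_inA_inN, LieDerivation.sub_apply, map_sub (LieInner.inN 𝔞)]
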